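/- Let $C$ be the hyperelliptic curve of genus $3$ over $\mathbb{C}$ given by $y^2=f(x)$, where $f\in\mathbb{C}[x]$ has degree $8$ and eight distinct roots (that is, $C$ is the smooth projective model of this equation). For $q\ge 1$ let $H^0(C,(\Omega^1)^q)$ be the complex vector space of holomorphic $q$-differentials on $C$. Then the following hold. (1) For every $\beta\in\mathbb{C}$, the three differentials $$\frac{(x-\beta)^j}{y}\,dx,\qquad 0\le j\le 2,$$ form a basis of $H^0(C,\Omega^1)$. (2) For every $\beta\in\mathbb{C}$ and every point $P=(\beta,c)$ of $C$ above $\beta$ (so $c^2=f(\beta)$), the six $2$-differentials $$\frac{(x-\beta)^j}{y^2}\,(dx)^2,\quad 0\le j\le 4,\qquad\text{and}\qquad \frac{y-T(x)}{y^2}\,(dx)^2$$ form a basis of $H^0(C,(\Omega^1)^2)$. Here $T=0$ if $f(\beta)=0$. If $f(\beta)\ne 0$, then $T(x)=\sum_{n=0}^{4}\frac{s^{(n)}(\beta)}{n!}(x-\beta)^n$ is the degree-$4$ Taylor polynomial at $\beta$ of the holomorphic function $s$ defined near $\beta$ by $s(x)^2=f(x)$, $s(\beta)=c$ (so that $y=s(x)$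 on $C$ near $P$). (3) For every integer $q\ge 2$ and every root $\beta$ of $f$, the $4q-2$ $q$-differentials $$\frac{(x-\beta)^j}{y^q}\,(dx)^q,\quad 0\le j\le 2q,\qquad\text{and}\qquad \frac{(x-\beta)^j\,y}{y^q}\,(dx)^q,\quad 0\le j\le 2q-4,$$ form a basis of $H^0(C,(\Omega^1)^q)$. -/

import Mathlib

open Polynomial TensorProduct KaehlerDifferential

/-- A genus 3 hyperelliptic curve `y ^ 2 = f(x)` over `ℂ` with `deg f = 8`.  The (smooth projective)
curve given by such an equation has genus 3 exactly when the eight roots of `f` are distinct. -/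
structure OcticCurve where
  /-- the right-hand side of the equation -/
  f : ℂ[X]
  natDegree_f : f.natDegree = 8
  separable_f : f.Separable

namespace OcticCurve

/-- The polynomial `Y ^ 2 - f(x)` in the variable `Y` over the rational function field `ℂ(x)`. -/
noncomputable def poly (C : OcticCurve) : (RatFunc ℂ)[X] :=
  X ^ 2 - Polynomial.C (algebraMap ℂ[X] (RatFunc ℂ) C.f)

theorem irreducible_poly (C : OcticCurve) : Irreducible C.poly := by
  unfold poly
  refine X_pow_sub_C_irreducible_of_prime Nat.prime_two fun g hg => ?_
  rw [pow_two, eq_comm] at hg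
  have hint : IsIntegral ℂ[X] g := by
    refine ⟨X ^ 2 - Polynomial.C C.f, monic_X_pow_sub_C _ two_ne_zero, ?_⟩
    simp [hg, pow_two]
  obtain ⟨p, rfl⟩ := (IsIntegrallyClosed.isIntegral_iff).1 hint
  rw [← map_mul] at hg
  have hp : C.f = p * p := IsFractionRing.injective ℂ[X] (RatFunc ℂ) hg
  have hu : IsUnit p := C.separable_f.squarefree p (hp ▸ dvd_rfl)
  have h8 := C.natDegree_f
  rw [hp, natDegree_eq_zero_of_isUnit (hu.mul hu)] at h8
  omega

instance (C : OcticCurve) : Fact (Irreducible C.poly) := ⟨C.irreducible_poly⟩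

/-- The function field `ℂ(C) = ℂ(x)[y] / (y ^ 2 - f(x))` of the curve. -/
abbrev FunctionField (C : OcticCurve) : Type := AdjoinRoot C.poly

/-- The coordinate function `x` on the curve. -/
noncomputable def x (C : OcticCurve) : C.FunctionField :=
  algebraMap (RatFunc ℂ) C.FunctionField RatFunc.X

/-- The coordinate function `y` on the curve. -/
noncomputable def y (C : OcticCurve) : C.FunctionField := AdjoinRoot.root C.poly

theorem y_sq (C : OcticCurve) : C.y ^ 2 = aeval C.x C.f := by
  have h : aeval C.y C.poly = 0 := by
    rw [y, AdjoinRoot.aeval_eq, AdjoinRoot.mk_self]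
  have h2 : aeval C.x C.f =
      algebraMap (RatFunc ℂ) C.FunctionField (algebraMap ℂ[X] (RatFunc ℂ) C.f) := by
    rw [x, aeval_algebraMap_apply, ← RatFunc.algebraMap_X, aeval_algebraMap_apply]
    simp
  have h3 : C.poly = X ^ 2 - Polynomial.C (algebraMap ℂ[X] (RatFunc ℂ) C.f) := rfl
  rw [h2, ← sub_eq_zero, ← h, congrArg (aeval C.y) h3]
  simp only [map_sub, map_pow, aeval_X, aeval_C]

/-- The points of the smooth projective model of the curve, given as the places of its function
field: the valuation rings `P` with `ℂ ⊆ P ⊊ ℂ(C)`.  (These are discrete valuation rings.) -/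
def IsPlace (C : OcticCurve) (P : ValuationSubring C.FunctionField) : Prop :=
  (∀ a : ℂ, algebraMap ℂ C.FunctionField a ∈ P) ∧ P ≠ ⊤

/-- The space of rational (meromorphic) `q`-differentials on the curve, i.e. the `q`-th tensor power
over `ℂ(C)` of the one-dimensional `ℂ(C)`-vector space of rational differentials. -/
abbrev QDifferential (C : OcticCurve) (q : ℕ) : Type :=
  ⨂[C.FunctionField]^q (Ω[C.FunctionField⁄ℂ])

/-- The `q`-differential `(dt) ^ q`, for a rational function `t`. -/
noncomputable def dPow (C : OcticCurve) (q : ℕ) (t : C.FunctionField) : C.QDifferential q :=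
  PiTensorProduct.tprod C.FunctionField (fun _ : Fin q => D ℂ C.FunctionField t)

/-- `ω` is holomorphic at `P` if, for local parameters `t` at `P`, it has the form `g (dt) ^ q` with
`g` regular at `P`. -/
def IsHolomorphicAt (C : OcticCurve) {q : ℕ} (ω : C.QDifferential q)
    (P : ValuationSubring C.FunctionField) : Prop :=
  ∀ t : P, Irreducible t → ∃ g : P, ω = (g : C.FunctionField) • C.dPow q (t : C.FunctionField)

/-- The complex vector space `H⁰(C, (Ω¹) ^ q)` of holomorphic `q`-differentials on the curve. -/
noncomputable def holomorphicQDifferentials (C : OcticCurve) (q : ℕ) :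
    Submodule ℂ (C.QDifferential q) where
  carrier := {ω | ∀ P : ValuationSubring C.FunctionField, C.IsPlace P → C.IsHolomorphicAt ω P}
  zero_mem' := fun _ _ _ _ => ⟨0, by simp⟩
  add_mem' := by
    intro a b ha hb P hP t ht
    obtain ⟨g, hg⟩ := ha P hP t ht
    obtain ⟨h, hh⟩ := hb P hP t ht
    exact ⟨g + h, by rw [hg, hh]; push_cast; rw [add_smul]⟩
  smul_mem' := by
    intro c a ha P hP t ht
    obtain ⟨g, hg⟩ := ha P hP t ht
    refine ⟨⟨algebraMap ℂ C.FunctionField c, hP.1 c⟩ * g, ?_⟩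
    rw [hg]
    push_cast
    rw [mul_smul, algebraMap_smul]

/-- The rational function `x - β`. -/
noncomputable def xSub (C : OcticCurve) (β : ℂ) : C.FunctionField :=
  C.x - algebraMap ℂ C.FunctionField β

/-- Near the point `(w, c)` of the curve (`c ^ 2 = f(w)`, `f(w) ≠ 0`), where `x - w` is a local
coordinate, the function `y` is the holomorphic function `s` of `x`. -/
structure IsBranchAt (C : OcticCurve) (w c : ℂ) (s : ℂ → ℂ) : Prop where
  analyticAt : AnalyticAt ℂ s w
  value : s w = c
  sq_eq : ∀ᶠ z in nhds w, s z ^ 2 = C.f.eval z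

theorem exists_isBranchAt (C : OcticCurve) (w c : ℂ) (hw : C.f.eval w ≠ 0)
    (hc : c ^ 2 = C.f.eval w) : ∃ s, C.IsBranchAt w c s := by
  have hf : AnalyticAt ℂ (fun z => C.f.eval z / C.f.eval w) w :=
    (AnalyticOnNhd.eval_polynomial C.f w (Set.mem_univ w)).div analyticAt_const hw
  have h1 : C.f.eval w / C.f.eval w = 1 := div_self hw
  refine ⟨fun z => c * (C.f.eval z / C.f.eval w) ^ (1 / 2 : ℂ),
    analyticAt_const.mul (hf.cpow analyticAt_const ?_), by simp [h1], ?_⟩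
  · rw [h1]
    exact Complex.one_mem_slitPlane
  · refine Filter.Eventually.of_forall fun z => ?_
    have h2 : ((C.f.eval z / C.f.eval w) ^ (1 / 2 : ℂ)) ^ 2 = C.f.eval z / C.f.eval w := by
      rw [← Complex.cpow_nat_mul]
      simp
    rw [mul_pow, h2, hc]
    field_simp

end OcticCurve

/-- The Taylor polynomial of degree 4 of `s` at `w`. -/
noncomputable def taylorFour (s : ℂ → ℂ) (w : ℂ) : ℂ[X] :=
  ∑ n ∈ Finset.range 5,
    Polynomial.C (iteratedDeriv n s w / (n.factorial : ℂ)) * (X - Polynomial.C w) ^ n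

/-- The family `v` is a basis of the subspace `W`. -/
def IsBasisOf {ι V : Type*} [AddCommGroup V] [Module ℂ V] (v : ι → V) (W : Submodule ℂ V) : Prop :=
  LinearIndependent ℂ v ∧ Submodule.span ℂ (Set.range v) = W

namespace OcticCurve

/-! Rational differentials form a one-dimensional space spanned by `dx`, so each `q`-differential is
`(g / y ^ q) (dx) ^ q` for a unique function `g`, and holomorphy becomes a condition on `g`.

At a place where `x` is finite, `dx / y` is holomorphic and nonvanishing: `x - w` is a local
parameter and `y` a unit if `f(w) ≠ 0`, while `y` is a local parameter and `2 dy = f'(x) dx / y` if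
`f(w) = 0`. So `g` must be regular at all finite places, hence integral over `ℂ[x]`, hence `g = a(x)
+ b(x) y` because `f` is squarefree. At a place over infinity `1/x` is a local parameter and `y` has
a pole of order 4, so `dx / y` has a zero of order 2 and `g` may have a pole of order at most `2q`.
Applying this to `g` and its conjugate under `y ↦ -y` bounds `a` and `b y` separately: `deg a ≤ 2q`
and `deg b ≤ 2q - 4`. This is `mem_holomorphicQDifferentials_iff`.

The space is thus a product of two spaces of polynomials of bounded degree, and powers of `x - β`
give bases. Replacing `y` by `y - T` is the shear `(a, b) ↦ (a - b T, b)`; for `q = 2` the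
polynomial `b` is constant and `deg T ≤ 4`, so the shear preserves the product. -/

instance (C : OcticCurve) : CharZero C.FunctionField :=
  charZero_of_injective_algebraMap (algebraMap ℂ C.FunctionField).injective

/-! ### The function field as a quadratic extension of `ℂ(x)`. -/

theorem algebraMap_eq_aeval_x (C : OcticCurve) (p : ℂ[X]) :
    algebraMap ℂ[X] C.FunctionField p = aeval C.x p := by
  have h : C.x = algebraMap ℂ[X] C.FunctionField X := by
    rw [x, IsScalarTower.algebraMap_apply ℂ[X] (RatFunc ℂ) C.FunctionField, RatFunc.algebraMap_X]
  rw [h, aeval_algebraMap_apply, aeval_X_left_apply]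

theorem aeval_x_injective (C : OcticCurve) :
    Function.Injective (aeval C.x : ℂ[X] → C.FunctionField) := by
  have h : (fun p => algebraMap (RatFunc ℂ) C.FunctionField (algebraMap ℂ[X] (RatFunc ℂ) p)) =
      (aeval C.x : ℂ[X] → C.FunctionField) := by
    ext p
    rw [← IsScalarTower.algebraMap_apply, algebraMap_eq_aeval_x]
  rw [← h]
  exact (algebraMap (RatFunc ℂ) C.FunctionField).injective.comp
    (IsFractionRing.injective ℂ[X] (RatFunc ℂ))

theorem aeval_x_eq_zero_iff (C : OcticCurve) {p : ℂ[X]} : aeval C.x p = 0 ↔ p = 0 :=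
  map_eq_zero_iff (aeval C.x) C.aeval_x_injective

theorem f_ne_zero (C : OcticCurve) : C.f ≠ 0 := by
  intro h
  have := C.natDegree_f
  simp [h] at this

theorem y_ne_zero (C : OcticCurve) : C.y ≠ 0 := by
  intro h
  have h2 := C.y_sq
  rw [h, zero_pow two_ne_zero, eq_comm, aeval_x_eq_zero_iff] at h2
  exact C.f_ne_zero h2

theorem x_ne_zero (C : OcticCurve) : C.x ≠ 0 := by
  intro h
  have : aeval C.x (X : ℂ[X]) = 0 := by simp [h]
  exact X_ne_zero (C.aeval_x_eq_zero_iff.1 this)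

/-- The hyperelliptic involution `y ↦ -y`. -/
noncomputable def involution (C : OcticCurve) :
    C.FunctionField →ₐ[RatFunc ℂ] C.FunctionField :=
  AdjoinRoot.liftAlgHom C.poly (Algebra.ofId _ _) (-C.y) (by
    have key : ∀ (i : RatFunc ℂ →+* C.FunctionField) (r : C.FunctionField),
        eval₂ i (-r) C.poly = eval₂ i r C.poly := fun i r => by simp [poly]
    exact (key _ _).trans (AdjoinRoot.eval₂_root C.poly))

theorem involution_y (C : OcticCurve) : C.involution C.y = -C.y := by
  simp [involution, y]

theorem involution_aeval_x (C : OcticCurve) (p : ℂ[X]) :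
    C.involution (aeval C.x p) = aeval C.x p := by
  rw [← algebraMap_eq_aeval_x, IsScalarTower.algebraMap_apply ℂ[X] (RatFunc ℂ) C.FunctionField,
    AlgHom.commutes]

theorem exists_eq_add_mul_y (C : OcticCurve) (g : C.FunctionField) :
    ∃ a b : RatFunc ℂ, g = algebraMap _ _ a + algebraMap _ _ b * C.y := by
  obtain ⟨p, rfl⟩ := AdjoinRoot.mk_surjective g
  have hm : C.poly.Monic := monic_X_pow_sub_C _ two_ne_zero
  have hd : (p %ₘ C.poly).natDegree < 2 := by
    have := natDegree_modByMonic_lt p hm (by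
      intro h
      have := C.irreducible_poly.not_isUnit
      simp [h] at this)
    rwa [show C.poly.natDegree = 2 from natDegree_X_pow_sub_C] at this
  refine ⟨(p %ₘ C.poly).coeff 0, (p %ₘ C.poly).coeff 1, ?_⟩
  have h : AdjoinRoot.mk C.poly p = AdjoinRoot.mk C.poly (p %ₘ C.poly) := by
    rw [AdjoinRoot.mk_eq_mk]
    exact ⟨p /ₘ C.poly, by rw [sub_eq_iff_eq_add', modByMonic_add_div]⟩
  rw [h]
  conv_lhs => rw [eq_X_add_C_of_natDegree_le_one (Nat.lt_succ_iff.1 hd)]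
  simp [y, AdjoinRoot.algebraMap_eq, add_comm]

theorem exists_mul_aeval_eq (C : OcticCurve) (g : C.FunctionField) :
    ∃ a b d : ℂ[X], d ≠ 0 ∧ g * aeval C.x d = aeval C.x a + aeval C.x b * C.y := by
  obtain ⟨a, b, rfl⟩ := C.exists_eq_add_mul_y g
  have key : ∀ r : RatFunc ℂ, algebraMap (RatFunc ℂ) C.FunctionField r * aeval C.x r.denom =
      aeval C.x r.num := by
    intro r
    rw [← algebraMap_eq_aeval_x, ← algebraMap_eq_aeval_x,
      IsScalarTower.algebraMap_apply ℂ[X] (RatFunc ℂ) C.FunctionField,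
      IsScalarTower.algebraMap_apply ℂ[X] (RatFunc ℂ) C.FunctionField, ← map_mul]
    congr 1
    nth_rw 1 [← RatFunc.num_div_denom r]
    exact div_mul_cancel₀ _ (by simpa using r.denom_ne_zero)
  refine ⟨a.num * b.denom, b.num * a.denom, a.denom * b.denom,
    mul_ne_zero a.denom_ne_zero b.denom_ne_zero, ?_⟩
  simp only [map_mul, ← key]
  ring

theorem eq_zero_of_add_mul_y_eq_zero (C : OcticCurve) {a b : ℂ[X]}
    (h : aeval C.x a + aeval C.x b * C.y = 0) : a = 0 ∧ b = 0 := by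
  have h2 := congrArg C.involution h
  simp only [map_add, map_mul, involution_aeval_x, involution_y, map_zero] at h2
  have ha : aeval C.x a = 0 := by linear_combination (h + h2) / 2
  have hb : aeval C.x b * C.y = 0 := by linear_combination (h - h2) / 2
  exact ⟨C.aeval_x_eq_zero_iff.1 ha,
    C.aeval_x_eq_zero_iff.1 ((mul_eq_zero.1 hb).resolve_right C.y_ne_zero)⟩

/-- Half the sum and half the difference of `g` and its conjugate show that `a` and `b y` are
integral, so `a` and `b² f` are polynomials. The square of the denominator of `b` then divides the
squarefree `f`, so `b` is a polynomial too. -/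
theorem exists_polynomial_of_isIntegral (C : OcticCurve) {g : C.FunctionField}
    (hg : IsIntegral ℂ[X] g) : ∃ a b : ℂ[X], g = aeval C.x a + aeval C.x b * C.y := by
  obtain ⟨a, b, rfl⟩ := C.exists_eq_add_mul_y g
  have hc := hg.map (C.involution.restrictScalars ℂ[X])
  simp only [AlgHom.restrictScalars_apply, map_add, map_mul, AlgHom.commutes, involution_y] at hc
  have hinj := (algebraMap (RatFunc ℂ) C.FunctionField).injective
  have descend : ∀ r : RatFunc ℂ, IsIntegral ℂ[X] (algebraMap (RatFunc ℂ) C.FunctionField r) →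
      ∃ p : ℂ[X], algebraMap _ _ p = r := fun r hr =>
    (IsIntegrallyClosed.isIntegral_iff).1 ((isIntegral_algebraMap_iff hinj).1 hr)
  have half : ∀ h : C.FunctionField, IsIntegral ℂ[X] h → IsIntegral ℂ[X] ((1 / 2 : ℂ) • h) :=
    fun h hh => by
      rw [← algebraMap_smul ℂ[X] (1 / 2 : ℂ) h]
      exact hh.smul _
  have ha : IsIntegral ℂ[X] (algebraMap (RatFunc ℂ) C.FunctionField a) := by
    convert half _ (hg.add hc) using 1
    rw [Algebra.smul_def, map_div₀, map_one, map_ofNat]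
    ring
  have hb : IsIntegral ℂ[X] (algebraMap (RatFunc ℂ) C.FunctionField b * C.y) := by
    convert half _ (hg.sub hc) using 1
    rw [Algebra.smul_def, map_div₀, map_one, map_ofNat]
    ring
  have hb2 : IsIntegral ℂ[X] (algebraMap (RatFunc ℂ) C.FunctionField
      (b ^ 2 * algebraMap ℂ[X] (RatFunc ℂ) C.f)) := by
    convert hb.pow 2 using 1
    rw [mul_pow, y_sq, map_mul, map_pow, ← algebraMap_eq_aeval_x,
      ← IsScalarTower.algebraMap_apply]
  obtain ⟨p, rfl⟩ := descend a ha
  obtain ⟨r, hr⟩ := descend _ hb2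
  have hdvd : b.denom * b.denom ∣ C.f := by
    have hd0 : algebraMap ℂ[X] (RatFunc ℂ) b.denom ≠ 0 := by simpa using b.denom_ne_zero
    have h1 : r * b.denom ^ 2 = b.num ^ 2 * C.f := by
      apply IsFractionRing.injective ℂ[X] (RatFunc ℂ)
      rw [map_mul, hr, map_mul, map_pow, map_pow]
      nth_rw 1 [← RatFunc.num_div_denom b]
      field_simp
    have h2 : IsCoprime (b.denom ^ 2) (b.num ^ 2) := (RatFunc.isCoprime_num_denom b).symm.pow
    rw [← pow_two]
    exact h2.dvd_of_dvd_mul_left ⟨r, by rw [← h1, mul_comm]⟩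
  have hu : IsUnit b.denom := C.separable_f.squarefree _ hdvd
  have h1 : b.denom = 1 := (RatFunc.monic_denom b).eq_one_of_isUnit hu
  refine ⟨p, b.num, ?_⟩
  rw [← algebraMap_eq_aeval_x, ← algebraMap_eq_aeval_x,
    IsScalarTower.algebraMap_apply ℂ[X] (RatFunc ℂ) C.FunctionField,
    IsScalarTower.algebraMap_apply ℂ[X] (RatFunc ℂ) C.FunctionField]
  nth_rw 1 [← RatFunc.num_div_denom b]
  rw [h1, map_one, div_one]

/-! ### Rational differentials and the derivation `d/dx`. -/

theorem formallyEtale_functionField (C : OcticCurve) :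
    Algebra.FormallyEtale ℂ[X] C.FunctionField := by
  have : Algebra.FormallyEtale ℂ[X] (RatFunc ℂ) :=
    Algebra.FormallyEtale.of_isLocalization (nonZeroDivisors ℂ[X])
  have hfin : Module.Finite (RatFunc ℂ) C.FunctionField :=
    (monic_X_pow_sub_C _ two_ne_zero : C.poly.Monic).finite_adjoinRoot
  have : Algebra.FormallyEtale (RatFunc ℂ) C.FunctionField :=
    Algebra.FormallyEtale.of_isSeparable _ _
  exact Algebra.FormallyEtale.comp ℂ[X] (RatFunc ℂ) C.FunctionField

/-- Since the function field is formally étale over `ℂ[x]`, its differentials are the base change of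
those of `ℂ[x]`, which are free on `dx`. -/
theorem exists_kaehler_equiv (C : OcticCurve) :
    ∃ e : Ω[C.FunctionField⁄ℂ] ≃ₗ[C.FunctionField] C.FunctionField,
      e (D ℂ C.FunctionField C.x) = 1 := by
  have := C.formallyEtale_functionField
  have hx : C.x = algebraMap ℂ[X] C.FunctionField X := by
    rw [x, IsScalarTower.algebraMap_apply ℂ[X] (RatFunc ℂ) C.FunctionField, RatFunc.algebraMap_X]
  refine ⟨(tensorKaehlerEquivOfFormallyEtale ℂ ℂ[X] C.FunctionField).symm ≪≫ₗ
    (polynomialEquiv ℂ).baseChange ℂ[X] C.FunctionField _ _ ≪≫ₗ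
    AlgebraTensorModule.rid ℂ[X] C.FunctionField C.FunctionField, ?_⟩
  rw [hx, LinearEquiv.trans_apply, LinearEquiv.trans_apply,
    tensorKaehlerEquivOfFormallyEtale_symm_D_algebraMap]
  simp

/-- The derivation `d/dx` of the function field. -/
noncomputable def derivX (C : OcticCurve) : Derivation ℂ C.FunctionField C.FunctionField :=
  (C.exists_kaehler_equiv.choose : _ →ₗ[C.FunctionField] _).compDer (D ℂ C.FunctionField)

theorem derivX_x (C : OcticCurve) : C.derivX C.x = 1 := C.exists_kaehler_equiv.choose_spec

theorem D_eq_derivX_smul (C : OcticCurve) (g : C.FunctionField) :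
    D ℂ C.FunctionField g = C.derivX g • D ℂ C.FunctionField C.x := by
  apply C.exists_kaehler_equiv.choose.injective
  rw [map_smul, C.exists_kaehler_equiv.choose_spec, smul_eq_mul, mul_one]
  rfl

theorem dPow_eq_smul (C : OcticCurve) (q : ℕ) (t : C.FunctionField) :
    C.dPow q t = C.derivX t ^ q • C.dPow q C.x := by
  unfold dPow
  rw [D_eq_derivX_smul, MultilinearMap.map_smul_univ]
  simp

theorem exists_eq_smul_dPow (C : OcticCurve) {q : ℕ} (ω : C.QDifferential q) :
    ∃ h : C.FunctionField, ω = h • C.dPow q C.x := by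
  induction ω using PiTensorProduct.induction_on with
  | smul_tprod r v =>
    have hv : ∀ i, ∃ c : C.FunctionField, v i = c • D ℂ C.FunctionField C.x := fun i =>
      ⟨C.exists_kaehler_equiv.choose (v i), by
        apply C.exists_kaehler_equiv.choose.injective
        rw [map_smul, C.exists_kaehler_equiv.choose_spec, smul_eq_mul, mul_one]⟩
    choose c hc using hv
    refine ⟨r * ∏ i, c i, ?_⟩
    rw [funext hc, MultilinearMap.map_smul_univ, mul_smul]
    rfl
  | add a b ha hb =>
    obtain ⟨g, hg⟩ := ha
    obtain ⟨h, hh⟩ := hb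
    exact ⟨g + h, by rw [hg, hh, add_smul]⟩

theorem dPow_x_ne_zero (C : OcticCurve) (q : ℕ) : C.dPow q C.x ≠ 0 := by
  intro h
  -- Multiplying the coordinates of the `q` factors gives a linear form that takes the value 1 on
  -- `(dx) ^ q`.
  have h2 := congrArg (PiTensorProduct.lift ((MultilinearMap.mkPiAlgebra C.FunctionField (Fin q)
    C.FunctionField).compLinearMap fun _ => C.exists_kaehler_equiv.choose.toLinearMap)) h
  rw [map_zero, dPow, PiTensorProduct.lift.tprod] at h2
  simp [C.exists_kaehler_equiv.choose_spec] at h2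

theorem smul_dPow_injective (C : OcticCurve) (q : ℕ) :
    Function.Injective fun h : C.FunctionField => h • C.dPow q C.x :=
  smul_left_injective _ (C.dPow_x_ne_zero q)

end OcticCurve

/-- The integral closure is an intersection of valuation rings. With `A = ℂ[x]` this turns
regularity at all finite places into integrality; with `A = ℂ` it produces a place at infinity. -/
theorem isIntegral_of_forall_mem_valuationSubring {A K : Type*} [CommRing A] [Field K] [Algebra A K]
    {g : K} (h : ∀ V : ValuationSubring K, (∀ a, algebraMap A K a ∈ V) → g ∈ V) :
    IsIntegral A g := by
  by_contra hg
  have : IsIntegrallyClosedIn (integralClosure A K).toSubring K :=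
    inferInstanceAs (IsIntegrallyClosedIn (integralClosure A K) K)
  obtain ⟨V, hV, hgV⟩ := Subring.exists_le_valuationSubring_of_isIntegrallyClosedIn
    (R := (integralClosure A K).toSubring) (x := g) hg
  exact hgV (h V fun a => hV (algebraMap_mem (integralClosure A K) a))

/-! ### Local parameters in a valuation ring containing `ℂ`, relative to a derivation. -/

namespace ValuationSubring

variable {K : Type*} [Field K] [Algebra ℂ K] {P : ValuationSubring K}

theorem valuation_algebraMap (hP : ∀ a : ℂ, algebraMap ℂ K a ∈ P) {c : ℂ} (hc : c ≠ 0) :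
    P.valuation (algebraMap ℂ K c) = 1 := by
  refine le_antisymm ((P.valuation_le_one_iff _).2 (hP c)) ?_
  have h := (P.valuation_le_one_iff _).2 (hP c⁻¹)
  rw [map_inv₀, map_inv₀] at h
  have h0 : P.valuation (algebraMap ℂ K c) ≠ 0 := by simpa using hc
  exact (inv_le_one₀ (zero_lt_iff.2 h0)).1 h

theorem aeval_mem (hP : ∀ a : ℂ, algebraMap ℂ K a ∈ P) {u : K} (hu : u ∈ P) (p : ℂ[X]) :
    aeval u p ∈ P := by
  induction p using Polynomial.induction_on' with
  | add p q hp hq => rw [map_add]; exact AddMemClass.add_mem hp hq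
  | monomial n a => rw [aeval_monomial]; exact MulMemClass.mul_mem (hP a) (pow_mem hu n)

theorem mem_of_valuation_sub_lt_one (hP : ∀ a : ℂ, algebraMap ℂ K a ∈ P) {u : K} {w : ℂ}
    (hu : P.valuation (u - algebraMap ℂ K w) < 1) : u ∈ P := by
  rw [← sub_add_cancel u (algebraMap ℂ K w)]
  exact AddMemClass.add_mem ((P.valuation_le_one_iff _).1 hu.le) (hP w)

theorem valuation_eq_one_of_sub_lt_one (hP : ∀ a : ℂ, algebraMap ℂ K a ∈ P) {u : K} {w : ℂ}
    (hu : P.valuation (u - algebraMap ℂ K w) < 1) (hw : w ≠ 0) : P.valuation u = 1 := by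
  rw [← valuation_algebraMap hP hw] at hu ⊢
  exact Valuation.map_eq_of_sub_lt _ hu

theorem valuation_aeval_sub_lt_one (hP : ∀ a : ℂ, algebraMap ℂ K a ∈ P) {u : K} {w : ℂ}
    (hu : P.valuation (u - algebraMap ℂ K w) < 1) (p : ℂ[X]) :
    P.valuation (aeval u p - algebraMap ℂ K (p.eval w)) < 1 := by
  have h : aeval u p - algebraMap ℂ K (p.eval w) =
      (u - algebraMap ℂ K w) * aeval u (p /ₘ (X - C w)) := by
    have h1 := congrArg (aeval u) (modByMonic_add_div p (X - C w))
    rw [modByMonic_X_sub_C_eq_C_eval] at h1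
    rw [← h1]
    simp
  rw [h, map_mul]
  exact mul_lt_one_of_lt_of_le hu ((P.valuation_le_one_iff _).2
    (aeval_mem hP (mem_of_valuation_sub_lt_one hP hu) _))

theorem valuation_aeval_eq_one (hP : ∀ a : ℂ, algebraMap ℂ K a ∈ P) {u : K} {w : ℂ}
    (hu : P.valuation (u - algebraMap ℂ K w) < 1) {p : ℂ[X]} (hp : p.eval w ≠ 0) :
    P.valuation (aeval u p) = 1 :=
  valuation_eq_one_of_sub_lt_one hP (valuation_aeval_sub_lt_one hP hu p) hp

/-- `g` is regular at `P` together with its derivative. -/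
def IsRegular (P : ValuationSubring K) (δ : Derivation ℂ K K) (g : K) : Prop :=
  g ∈ P ∧ δ g ∈ P

variable {δ : Derivation ℂ K K}

theorem IsRegular.add {g h : K} (hg : P.IsRegular δ g) (hh : P.IsRegular δ h) :
    P.IsRegular δ (g + h) :=
  ⟨AddMemClass.add_mem hg.1 hh.1, by rw [map_add]; exact AddMemClass.add_mem hg.2 hh.2⟩

theorem IsRegular.mul {g h : K} (hg : P.IsRegular δ g) (hh : P.IsRegular δ h) :
    P.IsRegular δ (g * h) :=
  ⟨MulMemClass.mul_mem hg.1 hh.1, by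
    rw [Derivation.leibniz]; exact AddMemClass.add_mem (MulMemClass.mul_mem hg.1 hh.2) (MulMemClass.mul_mem hh.1 hg.2)⟩

theorem IsRegular.inv {g : K} (hg : P.IsRegular δ g) (h1 : P.valuation g = 1) :
    P.IsRegular δ g⁻¹ := by
  have hm : g⁻¹ ∈ P := (P.valuation_le_one_iff _).1 (by rw [map_inv₀, h1, inv_one])
  refine ⟨hm, ?_⟩
  rw [Derivation.leibniz_inv]
  exact MulMemClass.mul_mem (NegMemClass.neg_mem (pow_mem hm 2)) hg.2

theorem IsRegular.aeval (hP : ∀ a : ℂ, algebraMap ℂ K a ∈ P) {u : K} (hu : P.IsRegular δ u)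
    (p : ℂ[X]) : P.IsRegular δ (aeval u p) :=
  ⟨aeval_mem hP hu.1 p, by
    rw [Derivation.map_aeval]; exact MulMemClass.mul_mem (aeval_mem hP hu.1 _) hu.2⟩

/-- `g` is a power of `π` times a unit of `P` with regular derivative. -/
def IsFactored (P : ValuationSubring K) (δ : Derivation ℂ K K) (π g : K) : Prop :=
  ∃ (n : ℤ) (e : K), P.valuation e = 1 ∧ P.IsRegular δ e ∧ g = π ^ n * e

theorem isFactored_of_isRegular {π g : K} (h1 : P.valuation g = 1) (hg : P.IsRegular δ g) :
    P.IsFactored δ π g := ⟨0, g, h1, hg, by simp⟩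

theorem isFactored_self {π : K} : P.IsFactored δ π π :=
  ⟨1, 1, map_one _, ⟨one_mem _, by simp⟩, by simp⟩

theorem IsFactored.mul {π g h : K} (hπ : π ≠ 0) (hg : P.IsFactored δ π g)
    (hh : P.IsFactored δ π h) : P.IsFactored δ π (g * h) := by
  obtain ⟨n, e, he1, he, rfl⟩ := hg
  obtain ⟨m, e', he1', he', rfl⟩ := hh
  exact ⟨n + m, e * e', by rw [map_mul, he1, he1', one_mul], he.mul he',
    by rw [zpow_add₀ hπ]; ring⟩

theorem IsFactored.inv {π g : K} (hg : P.IsFactored δ π g) : P.IsFactored δ π g⁻¹ := by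
  obtain ⟨n, e, he1, he, rfl⟩ := hg
  exact ⟨-n, e⁻¹, by rw [map_inv₀, he1, inv_one], he.inv he1, by rw [zpow_neg, mul_inv]⟩

theorem IsFactored.pow {π g : K} (hπ : π ≠ 0) (hg : P.IsFactored δ π g) (n : ℕ) :
    P.IsFactored δ π (g ^ n) := by
  induction n with
  | zero => exact ⟨0, 1, map_one _, ⟨one_mem _, by simp⟩, by simp⟩
  | succ n ih => rw [pow_succ]; exact ih.mul hπ hg

/-- `π` is a local parameter at `P`, and `δ` is a nonvanishing derivation near `P`. -/
structure IsLocalParameter (P : ValuationSubring K) (δ : Derivation ℂ K K) (π : K) : Prop where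
  valuation_lt_one : P.valuation π < 1
  ne_zero : π ≠ 0
  valuation_deriv : P.valuation (δ π) = 1
  isFactored : ∀ g : K, g ≠ 0 → P.IsFactored δ π g

theorem IsLocalParameter.exists_eq_pow_mul {π : K} (h : P.IsLocalParameter δ π) {g : K}
    (hg : g ∈ P) (hg0 : g ≠ 0) :
    ∃ (n : ℕ) (e : K), P.valuation e = 1 ∧ P.IsRegular δ e ∧ g = π ^ n * e := by
  obtain ⟨n, e, he1, he, rfl⟩ := h.isFactored g hg0
  rcases le_or_gt 0 n with hn | hn
  · lift n to ℕ using hn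
    exact ⟨n, e, he1, he, by rw [zpow_natCast]⟩
  · exfalso
    rw [← P.valuation_le_one_iff, map_mul, he1, mul_one, map_zpow₀] at hg
    have h0 : 0 < P.valuation π := zero_lt_iff.2 (by simpa using h.ne_zero)
    exact absurd hg (not_le.2 (one_lt_zpow_of_neg₀ h0 h.valuation_lt_one hn))

/-- Makes `π` one of the parameters `t` against which `IsHolomorphicAt` tests. -/
theorem IsLocalParameter.irreducible {π : K} (h : P.IsLocalParameter δ π) :
    Irreducible (⟨π, (P.valuation_le_one_iff _).1 h.valuation_lt_one.le⟩ : P) := by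
  refine ⟨fun hu => ?_, fun a b hab => ?_⟩
  · rw [P.valuation_eq_one_iff] at hu
    exact h.valuation_lt_one.ne hu
  · have hab' : π = a * b := congrArg Subtype.val hab
    have hab0 : (a : K) * b ≠ 0 := hab' ▸ h.ne_zero
    obtain ⟨n, e, he1, -, ha⟩ := h.exists_eq_pow_mul a.2 (left_ne_zero_of_mul hab0)
    obtain ⟨m, e', he1', -, hb⟩ := h.exists_eq_pow_mul b.2 (right_ne_zero_of_mul hab0)
    rw [P.valuation_eq_one_iff, P.valuation_eq_one_iff, ha, hb, map_mul, map_mul, he1, he1',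
      map_pow, map_pow, mul_one, mul_one]
    rcases Nat.eq_zero_or_pos n with rfl | hn
    · simp
    rcases Nat.eq_zero_or_pos m with rfl | hm
    · simp
    exfalso
    have hv := congrArg P.valuation hab'
    rw [ha, hb, map_mul, map_mul, map_mul, he1, he1', map_pow, map_pow, mul_one, mul_one,
      ← pow_add] at hv
    have h0 : 0 < P.valuation π := zero_lt_iff.2 (by simpa using h.ne_zero)
    have := pow_lt_pow_right_of_lt_one₀ h0 h.valuation_lt_one (show 1 < n + m by omega)
    rw [pow_one, ← hv] at this
    exact lt_irrefl _ this

/-- Irreducibility forces `t = π e` with `e` a unit, so `δ t = e δ π + π δ e`. The second term is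
small only because `δ e` is regular, which is why `IsFactored` records the derivative of the unit.
-/
theorem IsLocalParameter.valuation_deriv_of_irreducible {π : K} (h : P.IsLocalParameter δ π)
    {t : P} (ht : Irreducible t) : P.valuation (δ (t : K)) = 1 := by
  have ht0 : (t : K) ≠ 0 := by simpa using ht.ne_zero
  obtain ⟨n, e, he1, he, hte⟩ := h.exists_eq_pow_mul t.2 ht0
  have hπP := (P.valuation_le_one_iff _).1 h.valuation_lt_one.le
  have hn : n = 1 := by
    match n, hte with
    | 0, hte =>
      exfalso
      apply ht.not_isUnit
      rw [P.valuation_eq_one_iff, hte, pow_zero, one_mul, he1]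
    | 1, _ => rfl
    | n + 2, hte =>
      exfalso
      have hfac : t = (⟨π, hπP⟩ : P) * (⟨π, hπP⟩ ^ (n + 1) * ⟨e, he.1⟩) := by
        apply Subtype.ext
        rw [hte]
        push_cast
        ring
      rcases ht.isUnit_or_isUnit hfac with hu | hu
      · exact h.irreducible.not_isUnit hu
      · exact h.irreducible.not_isUnit
          (isUnit_of_mul_isUnit_left (isUnit_of_mul_isUnit_left ((pow_succ' (_ : P) n) ▸ hu)))
  rw [hte, hn, pow_one, Derivation.leibniz, smul_eq_mul, smul_eq_mul]
  have h1 : P.valuation (e * δ π) = 1 := by rw [map_mul, he1, h.valuation_deriv, one_mul]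
  rw [Valuation.map_add_eq_of_lt_right, h1]
  rw [h1, map_mul]
  exact mul_lt_one_of_lt_of_le h.valuation_lt_one ((P.valuation_le_one_iff _).2 he.2)

theorem isFactored_aeval (hP : ∀ a : ℂ, algebraMap ℂ K a ∈ P) {π u : K} {w : ℂ} (hπ : π ≠ 0)
    (hu : P.valuation (u - algebraMap ℂ K w) < 1) (hr : P.IsRegular δ u)
    (hf : P.IsFactored δ π (u - algebraMap ℂ K w)) {p : ℂ[X]} (hp : p ≠ 0) :
    P.IsFactored δ π (aeval u p) := by
  obtain ⟨r, hr1, hr2⟩ := exists_eq_pow_rootMultiplicity_mul_and_not_dvd p hp w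
  rw [hr1, map_mul, map_pow, map_sub, aeval_X, aeval_C]
  exact (hf.pow hπ _).mul hπ (isFactored_of_isRegular
    (valuation_aeval_eq_one hP hu fun h => hr2 (dvd_iff_isRoot.2 h)) (hr.aeval hP r))

/-- To check that `π` is a local parameter it suffices to factor functions `a(u) + b(u) v` where
`a` and `b` do not both vanish at the point. -/
theorem isFactored_of_isCoprime (hP : ∀ a : ℂ, algebraMap ℂ K a ∈ P) {π u v : K} {w : ℂ}
    (hπ : π ≠ 0) (hu : P.valuation (u - algebraMap ℂ K w) < 1) (hr : P.IsRegular δ u)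
    (hf : P.IsFactored δ π (u - algebraMap ℂ K w))
    (hgen : ∀ g : K, ∃ a b d : ℂ[X], aeval u d ≠ 0 ∧ g * aeval u d = aeval u a + aeval u b * v)
    (hcop : ∀ a b : ℂ[X], (a.eval w ≠ 0 ∨ b.eval w ≠ 0) → aeval u a + aeval u b * v ≠ 0 →
      P.IsFactored δ π (aeval u a + aeval u b * v)) (g : K) (hg : g ≠ 0) :
    P.IsFactored δ π g := by
  obtain ⟨a, b, d, hd, h⟩ := hgen g
  have hab : aeval u a + aeval u b * v ≠ 0 := h ▸ mul_ne_zero hg hd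
  have hab0 : a ≠ 0 ∨ b ≠ 0 := by
    by_contra! h0
    exact hab (by rw [h0.1, h0.2]; simp)
  have hfac : P.IsFactored δ π (aeval u a + aeval u b * v) := by
    obtain ⟨a', ha'⟩ := EuclideanDomain.gcd_dvd_left a b
    obtain ⟨b', hb'⟩ := EuclideanDomain.gcd_dvd_right a b
    set r := EuclideanDomain.gcd a b with hrdef
    have hr0 : r ≠ 0 := by
      rw [hrdef, Ne, EuclideanDomain.gcd_eq_zero_iff]
      tauto
    -- After division by the gcd, Bézout prevents the cofactors from both vanishing at `w`.
    have hbez : a' * EuclideanDomain.gcdA a b + b' * EuclideanDomain.gcdB a b = 1 := by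
      apply mul_left_cancel₀ hr0
      have := EuclideanDomain.gcd_eq_gcd_ab a b
      rw [← hrdef] at this
      calc _ = (r * a') * EuclideanDomain.gcdA a b + (r * b') * EuclideanDomain.gcdB a b := by ring
        _ = _ := by rw [← ha', ← hb', ← this, mul_one]
    have hne : a'.eval w ≠ 0 ∨ b'.eval w ≠ 0 := by
      by_contra! h0
      have := congrArg (eval w) hbez
      simp [h0.1, h0.2] at this
    have heq : aeval u a + aeval u b * v = aeval u r * (aeval u a' + aeval u b' * v) := by
      rw [ha', hb', map_mul, map_mul]
      ring
    rw [heq] at hab ⊢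
    exact (isFactored_aeval hP hπ hu hr hf hr0).mul hπ (hcop a' b' hne (right_ne_zero_of_mul hab))
  have hd0 : d ≠ 0 := fun h0 => hd (by rw [h0, map_zero])
  rw [eq_div_of_mul_eq hd h, div_eq_mul_inv]
  exact hfac.mul hπ (isFactored_aeval hP hπ hu hr hf hd0).inv

/-- At the place, `v` takes a value `c ≠ 0`. If `a + b v` is not a unit there, its conjugate `a - b
v` is, and their product `a² - b² F` is a polynomial in `u`, which factors. The functions `u`, `v`
are abstract so that both `x` and `1/x` can serve as `u`. -/
theorem isLocalParameter_of_unramified (hP : ∀ a : ℂ, algebraMap ℂ K a ∈ P) {u v : K} {w : ℂ}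
    {F : ℂ[X]} (hv : v ^ 2 = aeval u F) (hF : F.eval w ≠ 0)
    (hu : P.valuation (u - algebraMap ℂ K w) < 1)
    (hgen : ∀ g : K, ∃ a b d : ℂ[X], aeval u d ≠ 0 ∧ g * aeval u d = aeval u a + aeval u b * v)
    (hδ : δ u = 1) : P.IsLocalParameter δ (u - algebraMap ℂ K w) := by
  have : CharZero K := charZero_of_injective_algebraMap (algebraMap ℂ K).injective
  have hd : δ (u - algebraMap ℂ K w) = 1 := by rw [map_sub, hδ, Derivation.map_algebraMap, sub_zero]
  have hπ : u - algebraMap ℂ K w ≠ 0 := fun h => by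
    rw [h, map_zero] at hd
    exact zero_ne_one hd
  have hru : P.IsRegular δ u := ⟨mem_of_valuation_sub_lt_one hP hu, hδ ▸ one_mem _⟩
  have hv1 : P.valuation v = 1 := by
    have h := valuation_aeval_eq_one hP hu hF
    rw [← hv, map_pow] at h
    exact (pow_eq_one_iff.1 h).resolve_right two_ne_zero
  have hv0 : v ≠ 0 := fun h => by simp [h] at hv1
  have hrv : P.IsRegular δ v := by
    refine ⟨(P.valuation_le_one_iff _).1 hv1.le, ?_⟩
    have h := congrArg δ hv
    rw [Derivation.map_aeval, Derivation.leibniz_pow, hδ] at h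
    have h2 : δ v = aeval u (derivative F) * v⁻¹ * algebraMap ℂ K (2⁻¹) := by
      simp only [Nat.add_one_sub_one, pow_one, smul_eq_mul, nsmul_eq_mul, mul_one,
        Nat.cast_ofNat] at h
      rw [← h, map_inv₀, map_ofNat]
      field_simp
    rw [h2]
    exact MulMemClass.mul_mem (MulMemClass.mul_mem (aeval_mem hP hru.1 _)
      ((P.valuation_le_one_iff _).1 (by rw [map_inv₀, hv1, inv_one]))) (hP _)
  refine ⟨hu, hπ, by rw [hd, map_one],
    isFactored_of_isCoprime hP hπ hu hru isFactored_self hgen fun a b hab hne => ?_⟩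
  -- `F(u) - F(w) = (v - c)(v + c)` vanishes at the place, so one factor does; the place selects the
  -- sign of the root.
  obtain ⟨c, hc, hvc⟩ : ∃ c : ℂ, c ^ 2 = F.eval w ∧ P.valuation (v - algebraMap ℂ K c) < 1 := by
    obtain ⟨c, hc⟩ := IsAlgClosed.exists_pow_nat_eq (F.eval w) two_pos
    have h := valuation_aeval_sub_lt_one hP hu F
    have h2 : aeval u F - algebraMap ℂ K (F.eval w) =
        (v - algebraMap ℂ K c) * (v - algebraMap ℂ K (-c)) := by
      rw [← hv, ← hc, map_pow, map_neg]
      ring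
    rw [h2, map_mul] at h
    by_contra! hcon
    exact absurd h (not_lt.2 (one_le_mul (hcon c hc) (hcon (-c) (by rw [neg_sq, hc]))))
  have hc0 : c ≠ 0 := fun h => hF (by rw [← hc, h, zero_pow two_ne_zero])
  have hval : ∀ a b : ℂ[X], a.eval w + b.eval w * c ≠ 0 →
      P.valuation (aeval u a + aeval u b * v) = 1 := by
    intro a b h
    refine valuation_eq_one_of_sub_lt_one hP ?_ h
    have h2 : aeval u a + aeval u b * v - algebraMap ℂ K (a.eval w + b.eval w * c) =
        (aeval u a - algebraMap ℂ K (a.eval w)) +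
          ((aeval u b - algebraMap ℂ K (b.eval w)) * v +
            algebraMap ℂ K (b.eval w) * (v - algebraMap ℂ K c)) := by
      rw [map_add, map_mul]
      ring
    rw [h2]
    refine Valuation.map_add_lt _ (valuation_aeval_sub_lt_one hP hu a)
      (Valuation.map_add_lt _ ?_ ?_)
    · rw [map_mul, hv1, mul_one]
      exact valuation_aeval_sub_lt_one hP hu b
    · rw [mul_comm, map_mul]
      exact mul_lt_one_of_lt_of_le hvc ((P.valuation_le_one_iff _).2 (hP _))
  have hreg : ∀ a b : ℂ[X], P.IsRegular δ (aeval u a + aeval u b * v) := fun a b =>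
    (hru.aeval hP a).add ((hru.aeval hP b).mul hrv)
  by_cases h1 : a.eval w + b.eval w * c = 0
  · have h2 : a.eval w + (-b).eval w * c ≠ 0 := by
      intro h2
      rw [eval_neg] at h2
      have ha : a.eval w = 0 := by linear_combination (h1 + h2) / 2
      have hb : b.eval w * c = 0 := by linear_combination (h1 - h2) / 2
      rcases hab with hab | hab
      · exact hab ha
      · exact hab ((mul_eq_zero.1 hb).resolve_right hc0)
    have h3 := hval a (-b) h2
    have h30 : aeval u a + aeval u (-b) * v ≠ 0 := fun h => by rw [h, map_zero] at h3; exact zero_ne_one h3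
    have h4 : (aeval u a + aeval u b * v) * (aeval u a + aeval u (-b) * v) =
        aeval u (a ^ 2 - b ^ 2 * F) := by
      simp only [map_sub, map_mul, map_pow, map_neg, ← hv]
      ring
    have h5 : a ^ 2 - b ^ 2 * F ≠ 0 := fun h => mul_ne_zero hne h30 (by rw [h4, h, map_zero])
    rw [eq_div_of_mul_eq h30 h4, div_eq_mul_inv]
    exact (isFactored_aeval hP hπ hu hru isFactored_self h5).mul hπ
      (isFactored_of_isRegular h3 (hreg _ _)).inv
  · exact isFactored_of_isRegular (hval a b h1) (hreg a b)

/-- Writing `F = (X - w) F₁` gives `u - w = v² / F₁(u)`. Hence `a + b v` is a unit if `a(w) ≠ 0`,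
and `v` times a unit otherwise. With `δ u = v`, one gets `δ v = F'(u) / 2`, a unit because the root
is simple. -/
theorem isLocalParameter_of_ramified (hP : ∀ a : ℂ, algebraMap ℂ K a ∈ P) {u v : K} {w : ℂ}
    {F : ℂ[X]} (hv : v ^ 2 = aeval u F) (hv0 : v ≠ 0) (hF : F.eval w = 0)
    (hF' : (derivative F).eval w ≠ 0)
    (hu : P.valuation (u - algebraMap ℂ K w) < 1)
    (hgen : ∀ g : K, ∃ a b d : ℂ[X], aeval u d ≠ 0 ∧ g * aeval u d = aeval u a + aeval u b * v)
    (hδ : δ u = v) : P.IsLocalParameter δ v := by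
  have : CharZero K := charZero_of_injective_algebraMap (algebraMap ℂ K).injective
  obtain ⟨F₁, rfl⟩ := dvd_iff_isRoot.2 hF
  have hF1 : F₁.eval w ≠ 0 := by
    simpa using hF'
  have hv1 : P.valuation v < 1 := by
    have h := valuation_aeval_sub_lt_one hP hu ((X - C w) * F₁)
    rw [hF, map_zero, sub_zero, ← hv, map_pow] at h
    by_contra! hcon
    exact absurd h (not_lt.2 (one_le_pow₀ hcon))
  have hvP := (P.valuation_le_one_iff _).1 hv1.le
  have hru : P.IsRegular δ u := ⟨mem_of_valuation_sub_lt_one hP hu, hδ ▸ hvP⟩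
  have hdv : δ v = aeval u (derivative ((X - C w) * F₁)) * algebraMap ℂ K (2⁻¹) := by
    have h := congrArg δ hv
    rw [Derivation.map_aeval, Derivation.leibniz_pow, hδ] at h
    simp only [Nat.add_one_sub_one, pow_one, smul_eq_mul, nsmul_eq_mul,
      Nat.cast_ofNat] at h
    apply mul_left_cancel₀ hv0
    rw [map_inv₀, map_ofNat]
    linear_combination h / 2
  have hrv : P.IsRegular δ v :=
    ⟨hvP, hdv ▸ MulMemClass.mul_mem (aeval_mem hP hru.1 _) (hP _)⟩
  have hval1 := valuation_aeval_eq_one hP hu hF1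
  have hreg1 := hru.aeval hP F₁
  have hne1 : aeval u F₁ ≠ 0 := fun h => by simp [h] at hval1
  have hsub : u - algebraMap ℂ K w = v ^ 2 * (aeval u F₁)⁻¹ := by
    rw [hv]
    simp only [map_mul, map_sub, aeval_X, aeval_C]
    field_simp
  have hfac : P.IsFactored δ v (u - algebraMap ℂ K w) := by
    rw [hsub]
    exact (isFactored_self.pow hv0 2).mul hv0 (isFactored_of_isRegular hval1 hreg1).inv
  refine ⟨hv1, hv0, ?_,
    isFactored_of_isCoprime hP hv0 hu hru hfac hgen fun a b hab hne => ?_⟩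
  · rw [hdv, map_mul, valuation_aeval_eq_one hP hu hF', valuation_algebraMap hP (by simp), one_mul]
  have hsmall : ∀ g h : K, P.valuation g = 1 → h ∈ P → P.valuation (g + h * v) = 1 := by
    intro g h hg hh
    have hlt : P.valuation (h * v) < P.valuation g := by
      rw [hg, mul_comm, map_mul]
      exact mul_lt_one_of_lt_of_le hv1 ((P.valuation_le_one_iff _).2 hh)
    rw [Valuation.map_add_eq_of_lt_left _ hlt, hg]
  by_cases ha : a.eval w = 0
  · obtain ⟨a₁, rfl⟩ := dvd_iff_isRoot.2 ha
    have hb := hab.resolve_left (not_not.2 ha)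
    have heq : aeval u ((X - C w) * a₁) + aeval u b * v =
        v * (aeval u b + aeval u a₁ * (aeval u F₁)⁻¹ * v) := by
      simp only [map_mul, map_sub, aeval_X, aeval_C, hsub]
      ring
    have hr2 := (hru.aeval hP a₁).mul (hreg1.inv hval1)
    rw [heq]
    exact isFactored_self.mul hv0 (isFactored_of_isRegular
      (hsmall _ _ (valuation_aeval_eq_one hP hu hb) hr2.1)
      ((hru.aeval hP b).add (hr2.mul hrv)))
  · exact isFactored_of_isRegular
      (hsmall _ _ (valuation_aeval_eq_one hP hu ha) (hru.aeval hP b).1)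
      ((hru.aeval hP a).add ((hru.aeval hP b).mul hrv))

end ValuationSubring

/-! ### Holomorphy at the finite places. -/

namespace OcticCurve

/-- The factor `τ` normalizes `d/dx` so that `τ dt/dx` is a unit for every local parameter `t`; thus
`(dx) ^ q` is `τ ^ q` times a unit times `(dt) ^ q`. -/
theorem isHolomorphicAt_smul_dPow_iff (C : OcticCurve) {P : ValuationSubring C.FunctionField}
    {τ π : C.FunctionField} (hτ : τ ≠ 0) (hπ : P.IsLocalParameter (τ • C.derivX) π) (q : ℕ)
    (h : C.FunctionField) : C.IsHolomorphicAt (h • C.dPow q C.x) P ↔ h * τ ^ q ∈ P := by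
  have key : ∀ (t g : C.FunctionField), h • C.dPow q C.x = g • C.dPow q t ↔
      h * τ ^ q = g * (τ * C.derivX t) ^ q := by
    intro t g
    rw [C.dPow_eq_smul q t, smul_smul, (C.smul_dPow_injective q).eq_iff, mul_pow]
    have := pow_ne_zero q hτ
    constructor
    · rintro rfl
      ring
    · intro h1
      apply mul_right_cancel₀ this
      rw [h1]
      ring
  constructor
  · intro hol
    obtain ⟨g, hg⟩ := hol _ hπ.irreducible
    rw [(key _ _).1 hg]
    exact mul_mem g.2 (pow_mem ((P.valuation_le_one_iff _).1 hπ.valuation_deriv.le) q)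
  · intro hm t ht
    have h1 : P.valuation (τ * C.derivX t) = 1 := hπ.valuation_deriv_of_irreducible ht
    have h0 : τ * C.derivX (t : C.FunctionField) ≠ 0 := fun h => by
      rw [h, map_zero] at h1
      exact zero_ne_one h1
    have hi : (τ * C.derivX (t : C.FunctionField))⁻¹ ∈ P :=
      (P.valuation_le_one_iff _).1 (by rw [map_inv₀, h1, inv_one])
    refine ⟨⟨_, mul_mem hm (pow_mem hi q)⟩, (key _ _).2 ?_⟩
    change _ = h * τ ^ q * _ * _
    rw [mul_assoc, ← mul_pow, inv_mul_cancel₀ h0, one_pow, mul_one]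

theorem exists_mul_aeval_eq' (C : OcticCurve) (g : C.FunctionField) :
    ∃ a b d : ℂ[X], aeval C.x d ≠ 0 ∧ g * aeval C.x d = aeval C.x a + aeval C.x b * C.y := by
  obtain ⟨a, b, d, hd, h⟩ := C.exists_mul_aeval_eq g
  exact ⟨a, b, d, fun h0 => hd (C.aeval_x_eq_zero_iff.1 h0), h⟩

theorem y_mem (C : OcticCurve) {P : ValuationSubring C.FunctionField}
    (hP : ∀ a : ℂ, algebraMap ℂ C.FunctionField a ∈ P) (hx : C.x ∈ P) : C.y ∈ P := by
  rw [← P.valuation_le_one_iff]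
  have h := (P.valuation_le_one_iff _).2 (ValuationSubring.aeval_mem hP hx C.f)
  rw [← C.y_sq, map_pow] at h
  by_contra! hcon
  exact absurd h (not_le.2 (one_lt_pow₀ hcon two_ne_zero))

/-- If every `x - w` were a unit, then, as polynomials over `ℂ` split, so would be every nonzero
polynomial in `x`, and the valuation ring would be the whole field. -/
theorem exists_valuation_x_sub_lt_one (C : OcticCurve) {P : ValuationSubring C.FunctionField}
    (hP : C.IsPlace P) (hx : C.x ∈ P) :
    ∃ w : ℂ, P.valuation (C.x - algebraMap ℂ C.FunctionField w) < 1 := by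
  by_contra! hcon
  have hlin : ∀ w : ℂ, P.valuation (C.x - algebraMap ℂ C.FunctionField w) = 1 := fun w =>
    le_antisymm ((P.valuation_le_one_iff _).2 (sub_mem hx (hP.1 w))) (hcon w)
  have hpoly : ∀ p : ℂ[X], p ≠ 0 → P.valuation (aeval C.x p) = 1 := by
    intro p hp
    rw [(IsAlgClosed.splits p).eq_prod_roots, map_mul, aeval_C, map_mul,
      ValuationSubring.valuation_algebraMap hP.1 (leadingCoeff_ne_zero.2 hp), one_mul,
      map_multiset_prod, map_multiset_prod]
    apply Multiset.prod_eq_one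
    intro r hr
    simp only [Multiset.map_map, Multiset.mem_map, Function.comp_apply] at hr
    obtain ⟨w, -, rfl⟩ := hr
    rw [map_sub, aeval_X, aeval_C, hlin]
  refine hP.2 (eq_top_iff.2 fun g _ => ?_)
  obtain ⟨a, b, d, hd, h⟩ := C.exists_mul_aeval_eq g
  have hm : g * aeval C.x d ∈ P := by
    rw [h]
    exact add_mem (ValuationSubring.aeval_mem hP.1 hx a)
      (mul_mem (ValuationSubring.aeval_mem hP.1 hx b) (C.y_mem hP.1 hx))
  rw [← P.valuation_le_one_iff, map_mul, hpoly d hd, mul_one] at hm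
  exact (P.valuation_le_one_iff _).1 hm

theorem isLocalParameter_x_sub (C : OcticCurve) {P : ValuationSubring C.FunctionField}
    (hP : C.IsPlace P) {w : ℂ} (hw : P.valuation (C.x - algebraMap ℂ C.FunctionField w) < 1)
    (hf : C.f.eval w ≠ 0) :
    P.IsLocalParameter ((1 : C.FunctionField) • C.derivX)
      (C.x - algebraMap ℂ C.FunctionField w) :=
  ValuationSubring.isLocalParameter_of_unramified hP.1 C.y_sq hf hw C.exists_mul_aeval_eq'
    (by rw [one_smul, derivX_x])

theorem isLocalParameter_y (C : OcticCurve) {P : ValuationSubring C.FunctionField}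
    (hP : C.IsPlace P) {w : ℂ} (hw : P.valuation (C.x - algebraMap ℂ C.FunctionField w) < 1)
    (hf : C.f.eval w = 0) : P.IsLocalParameter (C.y • C.derivX) C.y := by
  refine ValuationSubring.isLocalParameter_of_ramified hP.1 C.y_sq C.y_ne_zero hf ?_ hw
    C.exists_mul_aeval_eq' ?_
  · intro h
    obtain ⟨a, b, hab⟩ := C.separable_f
    have := congrArg (eval w) hab
    simp [hf, h] at this
  · rw [Derivation.smul_apply, derivX_x, smul_eq_mul, mul_one]

theorem isHolomorphicAt_iff_of_x_mem (C : OcticCurve) {P : ValuationSubring C.FunctionField}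
    (hP : C.IsPlace P) (hx : C.x ∈ P) (q : ℕ) (g : C.FunctionField) :
    C.IsHolomorphicAt ((g / C.y ^ q) • C.dPow q C.x) P ↔ g ∈ P := by
  obtain ⟨w, hw⟩ := C.exists_valuation_x_sub_lt_one hP hx
  by_cases hf : C.f.eval w = 0
  · rw [C.isHolomorphicAt_smul_dPow_iff C.y_ne_zero (C.isLocalParameter_y hP hw hf),
      div_mul_cancel₀ _ (pow_ne_zero q C.y_ne_zero)]
  · rw [C.isHolomorphicAt_smul_dPow_iff one_ne_zero (C.isLocalParameter_x_sub hP hw hf),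
      one_pow, mul_one]
    have h := ValuationSubring.valuation_aeval_eq_one hP.1 hw hf
    rw [← C.y_sq, map_pow] at h
    have hy := (pow_eq_one_iff.1 h).resolve_right two_ne_zero
    rw [← P.valuation_le_one_iff, map_div₀, map_pow, hy, one_pow, div_one,
      P.valuation_le_one_iff]

/-! ### Holomorphy at the places over infinity. -/

theorem aeval_inv_reflect (C : OcticCurve) {N : ℕ} {p : ℂ[X]} (hp : p.natDegree ≤ N) :
    aeval C.x⁻¹ (reflect N p) * C.x ^ N = aeval C.x p := by
  let : Invertible C.x := invertibleOfNonzero C.x_ne_zero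
  have := eval₂_reflect_mul_pow (algebraMap ℂ C.FunctionField) C.x N p hp
  rwa [invOf_eq_inv] at this

theorem valuation_inv_x_lt_one (C : OcticCurve) {P : ValuationSubring C.FunctionField}
    (hx : C.x ∉ P) :
    P.valuation (C.x⁻¹ - algebraMap ℂ C.FunctionField 0) < 1 := by
  rw [map_zero, sub_zero, map_inv₀]
  rw [← P.valuation_le_one_iff, not_le] at hx
  exact inv_lt_one_of_one_lt₀ hx

theorem valuation_aeval_x (C : OcticCurve) {P : ValuationSubring C.FunctionField}
    (hP : C.IsPlace P) (hx : C.x ∉ P) {p : ℂ[X]} (hp : p ≠ 0) :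
    P.valuation (aeval C.x p) = P.valuation C.x ^ p.natDegree := by
  rw [← C.aeval_inv_reflect le_rfl, map_mul, map_pow,
    ValuationSubring.valuation_aeval_eq_one hP.1 (C.valuation_inv_x_lt_one hx), one_mul]
  rw [← coeff_zero_eq_eval_zero, coeff_reflect, revAt_le (Nat.zero_le _), Nat.sub_zero]
  exact leadingCoeff_ne_zero.2 hp

theorem valuation_y (C : OcticCurve) {P : ValuationSubring C.FunctionField}
    (hP : C.IsPlace P) (hx : C.x ∉ P) : P.valuation C.y = P.valuation C.x ^ 4 := by
  have h := C.valuation_aeval_x hP hx C.f_ne_zero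
  rw [← C.y_sq, map_pow, C.natDegree_f, show 8 = 4 * 2 from rfl, pow_mul] at h
  exact (pow_left_inj₀ zero_le zero_le two_ne_zero).1 h

/-- In the chart `u = 1/x`, `v = y / x ^ 4` the curve is `v² = F(u)`, where `F` is `f` with its
coefficients reversed. `F(0)` is the leading coefficient of `f`, so the unramified case applies at
`w = 0`; the factor `-x²` makes the derivative of `u` equal to 1. -/
theorem isLocalParameter_inv_x (C : OcticCurve) {P : ValuationSubring C.FunctionField}
    (hP : C.IsPlace P) (hx : C.x ∉ P) :
    P.IsLocalParameter ((-C.x ^ 2) • C.derivX)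
      (C.x⁻¹ - algebraMap ℂ C.FunctionField 0) := by
  have hx0 := C.x_ne_zero
  refine ValuationSubring.isLocalParameter_of_unramified hP.1 (v := C.y / C.x ^ 4)
    (F := reflect 8 C.f) ?_ ?_ (C.valuation_inv_x_lt_one hx) ?_ ?_
  · rw [div_pow, C.y_sq, ← C.aeval_inv_reflect C.natDegree_f.le]
    field_simp
  · rw [← coeff_zero_eq_eval_zero, coeff_reflect, revAt_le (Nat.zero_le _), Nat.sub_zero, ← C.natDegree_f]
    exact leadingCoeff_ne_zero.2 C.f_ne_zero
  · intro g
    obtain ⟨a, b, d, hd, h⟩ := C.exists_mul_aeval_eq' g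
    set N := a.natDegree + b.natDegree + d.natDegree with hN
    -- `y = x ^ 4 v` absorbs four powers of `x`, so `b` is reflected in degree `N` and the others in
    -- degree `N + 4`.
    refine ⟨reflect (N + 4) a, reflect N b, reflect (N + 4) d, fun h0 => hd ?_, ?_⟩
    · rw [← C.aeval_inv_reflect (N := N + 4) (by omega), h0, zero_mul]
    · rw [← C.aeval_inv_reflect (N := N + 4) (p := a) (by omega),
        ← C.aeval_inv_reflect (N := N) (p := b) (by omega),
        ← C.aeval_inv_reflect (N := N + 4) (p := d) (by omega)] at h
      apply mul_right_cancel₀ (pow_ne_zero (N + 4) hx0)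
      rw [mul_assoc, h]
      generalize aeval C.x⁻¹ (reflect (N + 4) a) = a'
      generalize aeval C.x⁻¹ (reflect N b) = b'
      field_simp
      ring
  · rw [Derivation.smul_apply, Derivation.leibniz_inv, derivX_x, smul_eq_mul, smul_eq_mul]
    field_simp

theorem isHolomorphicAt_iff_of_x_notMem (C : OcticCurve) {P : ValuationSubring C.FunctionField}
    (hP : C.IsPlace P) (hx : C.x ∉ P) (q : ℕ) (g : C.FunctionField) :
    C.IsHolomorphicAt ((g / C.y ^ q) • C.dPow q C.x) P ↔
      P.valuation g ≤ P.valuation C.x ^ (2 * q) := by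
  rw [C.isHolomorphicAt_smul_dPow_iff (neg_ne_zero.2 (pow_ne_zero 2 C.x_ne_zero))
    (C.isLocalParameter_inv_x hP hx), ← P.valuation_le_one_iff, map_mul, map_div₀, map_pow, map_pow,
    Valuation.map_neg, map_pow, C.valuation_y hP hx]
  have h0 : P.valuation C.x ≠ 0 := by simpa using C.x_ne_zero
  have h1 : P.valuation g / (P.valuation C.x ^ 4) ^ q * (P.valuation C.x ^ 2) ^ q =
      P.valuation g / P.valuation C.x ^ (2 * q) := by
    rw [← pow_mul, ← pow_mul, show 4 * q = 2 * q + 2 * q by ring, pow_add]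
    field_simp
  rw [h1, div_le_one₀ (zero_lt_iff.2 (pow_ne_zero _ h0))]

theorem valuation_le_pow_iff (C : OcticCurve) (P : ValuationSubring C.FunctionField)
    (g : C.FunctionField) (n : ℕ) :
    P.valuation g ≤ P.valuation C.x ^ n ↔ g / C.x ^ n ∈ P := by
  have h0 : P.valuation C.x ≠ 0 := by simpa using C.x_ne_zero
  rw [← P.valuation_le_one_iff, map_div₀, map_pow, div_le_one₀ (zero_lt_iff.2 (pow_ne_zero _ h0))]

/-! ### The global holomorphic differentials. -/

theorem exists_isPlace_x_notMem (C : OcticCurve) :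
    ∃ P : ValuationSubring C.FunctionField, C.IsPlace P ∧ C.x ∉ P := by
  by_contra! hcon
  have hint : IsIntegral ℂ C.x := isIntegral_of_forall_mem_valuationSubring fun V hV => by
    by_cases hV' : V = ⊤
    · rw [hV']
      trivial
    · exact hcon V ⟨hV, hV'⟩
  exact (minpoly.ne_zero hint) (C.aeval_x_eq_zero_iff.1 (minpoly.aeval ℂ C.x))

/-- The bounds encode `deg a ≤ 2q` and `deg b + 4 ≤ 2q`. For `q ≤ 1` the truncated `2 * q - 3` is 0,
which correctly forces `b = 0`. -/
theorem mem_holomorphicQDifferentials_iff (C : OcticCurve) (q : ℕ) (ω : C.QDifferential q) :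
    ω ∈ C.holomorphicQDifferentials q ↔
      ∃ a ∈ degreeLT ℂ (2 * q + 1), ∃ b ∈ degreeLT ℂ (2 * q - 3),
        ((aeval C.x a + aeval C.x b * C.y) / C.y ^ q) • C.dPow q C.x = ω := by
  constructor
  · intro hω
    obtain ⟨h, rfl⟩ := C.exists_eq_smul_dPow ω
    obtain ⟨g, rfl⟩ : ∃ g, h = g / C.y ^ q :=
      ⟨h * C.y ^ q, (mul_div_cancel_right₀ _ (pow_ne_zero q C.y_ne_zero)).symm⟩
    obtain ⟨a, b, rfl⟩ := C.exists_polynomial_of_isIntegral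
      (isIntegral_of_forall_mem_valuationSubring (A := ℂ[X]) (g := g) fun V hV => by
        by_cases hV' : V = ⊤
        · rw [hV']
          trivial
        have hx : C.x ∈ V := by simpa [algebraMap_eq_aeval_x] using hV X
        have hVp : C.IsPlace V :=
          ⟨fun c => by simpa [algebraMap_eq_aeval_x] using hV (Polynomial.C c), hV'⟩
        exact (C.isHolomorphicAt_iff_of_x_mem hVp hx q g).1 (hω V hVp))
    obtain ⟨P, hP, hx⟩ := C.exists_isPlace_x_notMem
    have h1 := (C.isHolomorphicAt_iff_of_x_notMem hP hx q _).1 (hω P hP)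
    have hσx : C.involution C.x = C.x := by simpa using C.involution_aeval_x X
    -- The conjugate of `P` is again a place over infinity; the condition there bounds `a - b y` at
    -- `P`.
    have hx' : C.x ∉ P.comap C.involution.toRingHom := by
      rw [ValuationSubring.mem_comap]
      change C.involution C.x ∉ P
      rwa [hσx]
    have hP' : C.IsPlace (P.comap C.involution.toRingHom) := by
      refine ⟨fun c => ?_, fun htop => ?_⟩
      · rw [ValuationSubring.mem_comap]
        change C.involution _ ∈ P
        rw [← aeval_C (x := C.x), involution_aeval_x, aeval_C]
        exact hP.1 c
      · exact hx' (htop ▸ ValuationSubring.mem_top _)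
    have h2 : P.valuation (aeval C.x a - aeval C.x b * C.y) ≤ P.valuation C.x ^ (2 * q) := by
      have h3 := (C.isHolomorphicAt_iff_of_x_notMem hP' hx' q _).1 (hω _ hP')
      rw [valuation_le_pow_iff, ValuationSubring.mem_comap] at h3
      change C.involution _ ∈ P at h3
      rw [map_div₀, map_pow, hσx, map_add, map_mul, involution_aeval_x, involution_aeval_x,
        involution_y, mul_neg, ← sub_eq_add_neg] at h3
      rwa [valuation_le_pow_iff]
    have hx1 : 1 < P.valuation C.x := by
      rwa [← P.valuation_le_one_iff, not_le] at hx
    have h2v : P.valuation (algebraMap ℂ C.FunctionField 2⁻¹) = 1 :=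
      ValuationSubring.valuation_algebraMap hP.1 (by simp)
    have ha : P.valuation (aeval C.x a) ≤ P.valuation C.x ^ (2 * q) := by
      have h3 := P.valuation.map_add_le h1 h2
      have h4 : aeval C.x a = (aeval C.x a + aeval C.x b * C.y +
          (aeval C.x a - aeval C.x b * C.y)) * algebraMap ℂ C.FunctionField 2⁻¹ := by
        rw [map_inv₀, map_ofNat]
        ring
      rwa [h4, map_mul, h2v, mul_one]
    have hb : P.valuation (aeval C.x b * C.y) ≤ P.valuation C.x ^ (2 * q) := by
      have h3 := P.valuation.map_sub_le h1 h2
      have h4 : aeval C.x b * C.y = (aeval C.x a + aeval C.x b * C.y -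
          (aeval C.x a - aeval C.x b * C.y)) * algebraMap ℂ C.FunctionField 2⁻¹ := by
        rw [map_inv₀, map_ofNat]
        ring
      rwa [h4, map_mul, h2v, mul_one]
    refine ⟨a, ?_, b, ?_, rfl⟩
    · rcases eq_or_ne a 0 with rfl | ha0
      · exact zero_mem _
      rw [C.valuation_aeval_x hP hx ha0, pow_le_pow_iff_right₀ hx1] at ha
      rw [mem_degreeLT, ← natDegree_lt_iff_degree_lt ha0]
      omega
    · rcases eq_or_ne b 0 with rfl | hb0
      · exact zero_mem _
      rw [map_mul, C.valuation_aeval_x hP hx hb0, C.valuation_y hP hx, ← pow_add,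
        pow_le_pow_iff_right₀ hx1] at hb
      rw [mem_degreeLT, ← natDegree_lt_iff_degree_lt hb0]
      omega
  · rintro ⟨a, ha, b, hb, rfl⟩ P hP
    by_cases hx : C.x ∈ P
    · rw [C.isHolomorphicAt_iff_of_x_mem hP hx]
      exact add_mem (ValuationSubring.aeval_mem hP.1 hx a)
        (mul_mem (ValuationSubring.aeval_mem hP.1 hx b) (C.y_mem hP.1 hx))
    · rw [C.isHolomorphicAt_iff_of_x_notMem hP hx]
      have hx1 : 1 < P.valuation C.x := by
        rwa [← P.valuation_le_one_iff, not_le] at hx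
      refine P.valuation.map_add_le ?_ ?_
      · rcases eq_or_ne a 0 with rfl | ha0
        · simp
        rw [mem_degreeLT, ← natDegree_lt_iff_degree_lt ha0] at ha
        rw [C.valuation_aeval_x hP hx ha0, pow_le_pow_iff_right₀ hx1]
        omega
      · rcases eq_or_ne b 0 with rfl | hb0
        · simp
        rw [mem_degreeLT, ← natDegree_lt_iff_degree_lt hb0] at hb
        rw [map_mul, C.valuation_aeval_x hP hx hb0, C.valuation_y hP hx, ← pow_add,
          pow_le_pow_iff_right₀ hx1]
        omega

-- Bases of polynomial spaces and their transport.

end OcticCurve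

theorem isBasisOf_X_sub_C_pow (β : ℂ) (n : ℕ) :
    IsBasisOf (fun j : Fin n => (X - C β) ^ (j : ℕ)) (degreeLT ℂ n) := by
  let S : Polynomial.Sequence ℂ :=
    { elems' := fun i => (X - C β) ^ i
      degree_eq' := fun i => by rw [degree_pow, degree_X_sub_C, nsmul_one] }
  refine ⟨S.linearIndependent.comp (fun j : Fin n => (j : ℕ)) Fin.val_injective, ?_⟩
  rw [← S.span_degreeLT (m := n) fun i _ => by simp [S.ne_zero]]
  congr 1
  ext p
  constructor
  · rintro ⟨j, rfl⟩
    exact ⟨j, j.2, rfl⟩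
  · rintro ⟨j, hj, rfl⟩
    exact ⟨⟨j, hj⟩, rfl⟩

theorem IsBasisOf.map {ι V W : Type*} [AddCommGroup V] [Module ℂ V] [AddCommGroup W] [Module ℂ W]
    {v : ι → V} {S : Submodule ℂ V} (h : IsBasisOf v S) (φ : V →ₗ[ℂ] W)
    (hφ : Function.Injective φ) : IsBasisOf (φ ∘ v) (S.map φ) := by
  refine ⟨h.1.map' φ (LinearMap.ker_eq_bot.2 hφ), ?_⟩
  rw [Set.range_comp, Submodule.span_image, h.2]

theorem IsBasisOf.prod {ι κ V W : Type*} [AddCommGroup V] [Module ℂ V] [AddCommGroup W]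
    [Module ℂ W] {v : ι → V} {w : κ → W} {S : Submodule ℂ V} {T : Submodule ℂ W}
    (hv : IsBasisOf v S) (hw : IsBasisOf w T) :
    IsBasisOf (Sum.elim (fun i => (v i, (0 : W))) (fun k => ((0 : V), w k))) (S.prod T) := by
  refine ⟨linearIndependent_inl_union_inr' hv.1 hw.1, ?_⟩
  rw [Set.Sum.elim_range, Submodule.span_union]
  have h1 : Set.range (fun i => (v i, (0 : W))) = LinearMap.inl ℂ V W '' Set.range v := by
    rw [← Set.range_comp]
    rfl
  have h2 : Set.range (fun k => ((0 : V), w k)) = LinearMap.inr ℂ V W '' Set.range w := by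
    rw [← Set.range_comp]
    rfl
  rw [h1, h2, Submodule.span_image, Submodule.span_image, hv.2, hw.2,
    LinearMap.prod_eq_sup_map]

theorem IsBasisOf.unit_of_fin_one {V : Type*} [AddCommGroup V] [Module ℂ V] {v : Fin 1 → V}
    {S : Submodule ℂ V} (h : IsBasisOf v S) : IsBasisOf (fun _ : Unit => v 0) S := by
  refine ⟨h.1.comp (fun _ : Unit => 0) (fun _ _ _ => rfl), ?_⟩
  rw [← h.2]
  congr 1
  ext p
  simp [eq_comm]

theorem taylorFour_mem_degreeLT (s : ℂ → ℂ) (w : ℂ) : taylorFour s w ∈ degreeLT ℂ 5 := by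
  refine Submodule.sum_mem _ fun n hn => ?_
  rw [mem_degreeLT, ← smul_eq_C_mul]
  refine (degree_smul_le _ _).trans_lt ?_
  rw [degree_pow, degree_X_sub_C, nsmul_one]
  exact_mod_cast Finset.mem_range.1 hn

namespace OcticCurve

/-- The differential `(a(x) + b(x) (y - T(x))) / y ^ q (dx) ^ q` as a linear function of `(a, b)`. -/
noncomputable def differentialOfPair (C : OcticCurve) (q : ℕ) (T : ℂ[X]) :
    ℂ[X] × ℂ[X] →ₗ[ℂ] C.QDifferential q where
  toFun p := ((aeval C.x p.1 + aeval C.x p.2 * (C.y - aeval C.x T)) / C.y ^ q) • C.dPow q C.x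
  map_add' p r := by
    rw [← add_smul, ← add_div, Prod.fst_add, Prod.snd_add, map_add, map_add]
    ring_nf
  map_smul' c p := by
    rw [Prod.smul_fst, Prod.smul_snd, map_smul, map_smul, RingHom.id_apply, smul_mul_assoc,
      ← smul_add, smul_div_assoc, smul_assoc]

theorem differentialOfPair_apply (C : OcticCurve) (q : ℕ) (T a b : ℂ[X]) :
    C.differentialOfPair q T (a, b) =
      ((aeval C.x a + aeval C.x b * (C.y - aeval C.x T)) / C.y ^ q) • C.dPow q C.x := rfl

theorem differentialOfPair_eq (C : OcticCurve) (q : ℕ) (T a b : ℂ[X]) :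
    C.differentialOfPair q T (a, b) = C.differentialOfPair q 0 (a - b * T, b) := by
  simp only [differentialOfPair_apply, map_sub, map_mul, map_zero, sub_zero]
  ring_nf

theorem differentialOfPair_injective (C : OcticCurve) (q : ℕ) (T : ℂ[X]) :
    Function.Injective (C.differentialOfPair q T) := by
  rw [injective_iff_map_eq_zero]
  rintro ⟨a, b⟩ h
  rw [differentialOfPair_eq, differentialOfPair_apply, smul_eq_zero,
    or_iff_left (C.dPow_x_ne_zero q), div_eq_zero_iff,
    or_iff_left (pow_ne_zero q C.y_ne_zero), map_zero, sub_zero] at h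
  obtain ⟨h1, rfl⟩ := C.eq_zero_of_add_mul_y_eq_zero h
  rw [zero_mul, sub_zero] at h1
  rw [h1]
  rfl

/-- The hypothesis on `T` says that the shear `(a, b) ↦ (a - b T, b)` and its inverse preserve the
degree bounds. -/
theorem map_differentialOfPair (C : OcticCurve) (q : ℕ) {T : ℂ[X]}
    (hT : ∀ b ∈ degreeLT ℂ (2 * q - 3), b * T ∈ degreeLT ℂ (2 * q + 1)) :
    ((degreeLT ℂ (2 * q + 1)).prod (degreeLT ℂ (2 * q - 3))).map (C.differentialOfPair q T) =
      C.holomorphicQDifferentials q := by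
  ext ω
  rw [mem_holomorphicQDifferentials_iff, Submodule.mem_map]
  constructor
  · rintro ⟨⟨a, b⟩, ⟨ha, hb⟩, rfl⟩
    refine ⟨a - b * T, sub_mem ha (hT b hb), b, hb, ?_⟩
    rw [differentialOfPair_eq, differentialOfPair_apply, map_zero, sub_zero]
  · rintro ⟨a, ha, b, hb, rfl⟩
    refine ⟨(a + b * T, b), ⟨add_mem ha (hT b hb), hb⟩, ?_⟩
    rw [differentialOfPair_eq, differentialOfPair_apply, map_zero, sub_zero, add_sub_cancel_right]

theorem aeval_X_sub_C_pow (C : OcticCurve) (β : ℂ) (n : ℕ) :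
    aeval C.x ((X - Polynomial.C β) ^ n) = C.xSub β ^ n := by
  rw [map_pow, map_sub, aeval_X, aeval_C, xSub]

theorem isBasisOf_holomorphicQDifferentials (C : OcticCurve) {q : ℕ} {T : ℂ[X]}
    (hT : ∀ b ∈ degreeLT ℂ (2 * q - 3), b * T ∈ degreeLT ℂ (2 * q + 1)) (β : ℂ) {ι : Type*}
    {v : ι → ℂ[X]} (hv : IsBasisOf v (degreeLT ℂ (2 * q - 3))) :
    IsBasisOf
      (Sum.elim
        (fun j : Fin (2 * q + 1) => (C.xSub β ^ (j : ℕ) / C.y ^ q) • C.dPow q C.x)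
        (fun i => (aeval C.x (v i) * (C.y - aeval C.x T) / C.y ^ q) • C.dPow q C.x))
      (C.holomorphicQDifferentials q) := by
  have h := ((isBasisOf_X_sub_C_pow β (2 * q + 1)).prod hv).map (C.differentialOfPair q T)
    (C.differentialOfPair_injective q T)
  rw [C.map_differentialOfPair q hT] at h
  convert h using 1
  ext (j | i)
  · simp only [Sum.elim_inl, Function.comp_apply, differentialOfPair_apply, aeval_X_sub_C_pow,
      map_zero, zero_mul, add_zero]
  · simp only [Sum.elim_inr, Function.comp_apply, differentialOfPair_apply, map_zero, zero_add]

theorem isBasisOf_holomorphicDifferentials (C : OcticCurve) (β : ℂ) :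
    IsBasisOf (fun j : Fin 3 => (C.xSub β ^ (j : ℕ) / C.y) • C.dPow 1 C.x)
      (C.holomorphicQDifferentials 1) := by
  -- Here `2 * 1 - 3 = 0`, so the second summand of the index type is the empty `Fin 0`.
  have h := C.isBasisOf_holomorphicQDifferentials (q := 1) (T := 0)
    (fun b _ => by rw [mul_zero]; exact zero_mem _) β
    (isBasisOf_X_sub_C_pow β (2 * 1 - 3))
  refine ⟨?_, ?_⟩
  · convert h.1.comp Sum.inl Sum.inl_injective using 1
    ext j
    simp
  · rw [← h.2]
    congr 1
    ext ω
    simp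

theorem isBasisOf_holomorphicQuadraticDifferentials (C : OcticCurve) (β : ℂ) {T : ℂ[X]}
    (hT : T ∈ degreeLT ℂ 5) :
    IsBasisOf
      (Sum.elim
        (fun j : Fin 5 => (C.xSub β ^ (j : ℕ) / C.y ^ 2) • C.dPow 2 C.x)
        (fun _ : Unit => ((C.y - aeval C.x T) / C.y ^ 2) • C.dPow 2 C.x))
      (C.holomorphicQDifferentials 2) := by
  have h := C.isBasisOf_holomorphicQDifferentials (q := 2) (T := T) (fun b hb => by
      rw [mem_degreeLT] at hb
      have hb0 : b.degree ≤ 0 := Nat.WithBot.lt_one_iff_le_zero.1 (by simpa using hb)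
      rw [eq_C_of_degree_le_zero hb0, ← smul_eq_C_mul]
      exact Submodule.smul_mem _ _ hT) β
    (isBasisOf_X_sub_C_pow β (2 * 2 - 3)).unit_of_fin_one
  simpa using h

end OcticCurve

theorem mainTheorem3 (C : OcticCurve) :
    -- `q = 1`, any `β`
    (∀ β : ℂ,
      IsBasisOf (fun j : Fin 3 => (C.xSub β ^ (j : ℕ) / C.y) • C.dPow 1 C.x)
        (C.holomorphicQDifferentials 1)) ∧
    -- `q = 2`, `β` a root of `f`
    (∀ β : ℂ, C.f.eval β = 0 →
      IsBasisOf
        (Sum.elim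
          (fun j : Fin 5 => (C.xSub β ^ (j : ℕ) / C.y ^ 2) • C.dPow 2 C.x)
          (fun _ : Unit => (C.y / C.y ^ 2) • C.dPow 2 C.x))
        (C.holomorphicQDifferentials 2)) ∧
    -- `q = 2`, `β` not a root of `f`, and `(β, c)` one of the two points above `β`
    (∀ β c : ℂ, C.f.eval β ≠ 0 → c ^ 2 = C.f.eval β → ∀ s : ℂ → ℂ, C.IsBranchAt β c s →
      IsBasisOf
        (Sum.elim
          (fun j : Fin 5 => (C.xSub β ^ (j : ℕ) / C.y ^ 2) • C.dPow 2 C.x)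
          (fun _ : Unit =>
            ((C.y - Polynomial.aeval C.x (taylorFour s β)) / C.y ^ 2) • C.dPow 2 C.x))
        (C.holomorphicQDifferentials 2)) ∧
    -- `q ≥ 2`, `β` a root of `f`
    (∀ q : ℕ, 2 ≤ q → ∀ β : ℂ, C.f.eval β = 0 →
      IsBasisOf
        (Sum.elim
          (fun j : Fin (2 * q + 1) => (C.xSub β ^ (j : ℕ) / C.y ^ q) • C.dPow q C.x)
          (fun j : Fin (2 * q - 4 + 1) =>
            (C.xSub β ^ (j : ℕ) * C.y / C.y ^ q) • C.dPow q C.x))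
        (C.holomorphicQDifferentials q)) := by
  refine ⟨C.isBasisOf_holomorphicDifferentials, fun β _ => ?_, fun β c _ _ s _ =>
    C.isBasisOf_holomorphicQuadraticDifferentials β (taylorFour_mem_degreeLT s β),
    fun q hq β _ => ?_⟩
  · simpa using C.isBasisOf_holomorphicQuadraticDifferentials β (zero_mem (degreeLT ℂ 5))
  · have hv := isBasisOf_X_sub_C_pow β (2 * q - 4 + 1)
    -- With truncated subtraction this equality needs `2 ≤ q`: for `q = 1` the sides are 1 and 0.
    rw [show 2 * q - 4 + 1 = 2 * q - 3 by omega] at hv ⊢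
    have h := C.isBasisOf_holomorphicQDifferentials (q := q) (T := 0)
      (fun b _ => by rw [mul_zero]; exact zero_mem _) β hv
    simpa only [OcticCurve.aeval_X_sub_C_pow, map_zero, sub_zero] using h
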